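/- Let $2\le a\le b$ be integers, $p=ab$ and let $t\ge p$. A block array is a map $s:\{1,\dots,a\}\times\{1,\dots,b\}\to\{1,\dots,t\}$ assigning treatments to the plots of an $a\times b$ block, and $\mathcal S$ is the set of all block arrays. Consider the two-dimensional interference model, in which the response on a plot is the sum of an overall mean, a block effect, the direct effect of the treatment on that plot, the side effects of the treatments on its (at most four) row and column neighbours (the side effect of a treatment does not depend on the direction, and there are no guard plots or edge effects), and an error of mean zero; the errors have within-block covariance matrix $\Sigma=I_p$ and are uncorrelated between blocks. For $s\in\mathcal S$ let $T_s$ be the $p\times t$ plot–treatment incidence matrix and $F_s=MT_s$, where $M=(K_b\otimes I_a)+(K_b'\otimes I_a)+(I_b\otimes K_a)+(I_b\otimes K_a')$ and $K_h=(\mathbb 1[i-j=1])_{1\le i,j\le h}$. With $B_m=I_m-J_m/m$, where $J_m$ is the all-ones $m\times m$ matrix, put $$c_{s00}=\operatorname{tr}(B_tT_s'B_pT_s),\quad c_{s01}=\operatorname{tr}(B_tT_s'B_pF_s),\quad c_{s11}=\operatorname{tr}(B_tF_s'B_pF_s),\quad q_s(x)=c_{s00}+2c_{s01}x+c_{s11}x^2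 .$$ For a probability vector $\xi=(p_s)_{s\in\mathcal S}$ let $c_{\xi ij}=\sum_s p_sc_{sij}$, $q_\xi(x)=\sum_sp_sq_s(x)$ and $q^*_\xi=c_{\xi00}-c_{\xi01}^2/c_{\xi11}$ (if $c_{\xi11}=0$, then $c_{\xi01}=0$ and the quotient is read as $0$). Let $r(x)=\max_\xi q_\xi(x)$, let $x^*$ be the unique minimizer of $r$ on $\mathbb R$, let $y^*=\max_\xi q^*_\xi=r(x^*)$, and let $\mathcal Q=\{s\in\mathcal S: q_s(x^*)=y^*\}$. A treatment is significant in $s$ if it appears exactly twice, on two adjacent plots, at least one of which is a corner of the block; it is strictly significant if both plots are corners. Let $\mathcal Q_i$ be the set of block arrays with exactly $i$ significant treatments and exactly $ab-2i$ treatments replicated exactly once, and let $\mathcal Q_j^*\subset\mathcal Q_j$ consist of the arrays all of whose significant treatments are strictly significant. Put $$\eta=4p-2a-2b-\frac{2(8ab-7a-7b+4)}{t}+\frac{4(2p-a-b)^2}{pt}.$$ Then $x^*$ exists, $\max_\xi q_\xi^*=r(x^*)$, and the following hold. (I) If $a\ge3$, then $$x^*=\frac{(2p-5)-\sqrt{(2p-5)^2-24}}{12},$$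 which is irrational, $$y^*=p-\frac{p+2}{p}+2\Big(\frac{2a+2b-5}{p}-2\Big)x^*+\Big(\eta-\frac{16p-14a-14b+20}{p}\Big)x^{*2},\qquad \mathcal Q=\bigcup_{i=0}^4\mathcal Q_i .$$ (II) If $a=2$ and $b\ge3$, then $$x^*=\frac{b-1-\sqrt{(b-1)^2-1}}{2},\quad y^*=2b-1+\Big(\frac4b-6\Big)x^*+\Big(\eta-9+\frac{10}{b}\Big)x^{*2},\quad \mathcal Q=\mathcal Q_0\cup\mathcal Q_1^*\cup\mathcal Q_2^*.$$ (III) If $a=b=2$, then $x^*=\tfrac12$, $y^*=2$ and $\mathcal Q=\mathcal Q_0\cup\mathcal Q_1^*\cup\mathcal Q_2^*$. -/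

import Mathlib

open scoped Kronecker Matrix

noncomputable section

namespace Interference

/-- The plots of an `a × b` block. The plot in row `i` and column `j` is the pair `(j, i)`,
so that the Kronecker products `X ⊗ₖ Y` below have the column factor first. -/
abbrev Plot (a b : ℕ) : Type := Fin b × Fin a

/-- The set `𝒮` of block arrays: `s i j` is the treatment assigned to row `i`, column `j`. -/
abbrev BlockArray (a b t : ℕ) : Type := Fin a → Fin b → Fin t

/-- The treatment of the array `s` on the plot `u`. -/
def BlockArray.treat {a b t : ℕ} (s : BlockArray a b t) (u : Plot a b) : Fin t := s u.2 u.1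

/-! ### Design matrices and information matrices -/

/-- The shift matrix `K_h = (𝟙[i - j = 1])`. -/
def shiftK (h : ℕ) : Matrix (Fin h) (Fin h) ℝ :=
  Matrix.of fun i j => if (i : ℕ) = (j : ℕ) + 1 then 1 else 0

/-- The incidence matrix of the direct treatment effects. -/
def directMat {a b t : ℕ} (s : BlockArray a b t) : Matrix (Plot a b) (Fin t) ℝ :=
  Matrix.of fun u m => if s.treat u = m then 1 else 0

/-- The incidence matrix of the side effects from the four directions, without guard plots. -/
def sideMat {a b t : ℕ} (s : BlockArray a b t) : Matrix (Plot a b) (Fin t) ℝ :=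
  (((1 : Matrix (Fin b) (Fin b) ℝ) ⊗ₖ shiftK a) * directMat s)
    + (((1 : Matrix (Fin b) (Fin b) ℝ) ⊗ₖ (shiftK a)ᵀ) * directMat s)
    + ((shiftK b ⊗ₖ (1 : Matrix (Fin a) (Fin a) ℝ)) * directMat s)
    + (((shiftK b)ᵀ ⊗ₖ (1 : Matrix (Fin a) (Fin a) ℝ)) * directMat s)

/-- The all-ones square matrix. -/
def allOnes (ι : Type) : Matrix ι ι ℝ := Matrix.of fun _ _ => 1

/-- `B̃ = Σ⁻¹ - Σ⁻¹ J Σ⁻¹ (1' Σ⁻¹ 1)⁻¹` for a within-block covariance matrix `Σ`. -/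
def Btilde {a b : ℕ} (Sig : Matrix (Plot a b) (Plot a b) ℝ) : Matrix (Plot a b) (Plot a b) ℝ :=
  Sig⁻¹ - ((fun _ => (1 : ℝ)) ⬝ᵥ (Sig⁻¹ *ᵥ fun _ => (1 : ℝ)))⁻¹ •
    (Sig⁻¹ * allOnes (Plot a b) * Sig⁻¹)

/-- The centering matrix `B_t = I_t - J_t / t`. -/
def centering (t : ℕ) : Matrix (Fin t) (Fin t) ℝ := 1 - (t : ℝ)⁻¹ • allOnes (Fin t)

variable {a b t : ℕ}

/-- `C_{s00} = T' B̃ T`. -/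
def C00 (Sig : Matrix (Plot a b) (Plot a b) ℝ) (s : BlockArray a b t) :
    Matrix (Fin t) (Fin t) ℝ := (directMat s)ᵀ * Btilde Sig * directMat s

/-- `C_{s01} = T' B̃ F`. -/
def C01 (Sig : Matrix (Plot a b) (Plot a b) ℝ) (s : BlockArray a b t) :
    Matrix (Fin t) (Fin t) ℝ := (directMat s)ᵀ * Btilde Sig * sideMat s

/-- `C_{s11} = F' B̃ F`. -/
def C11 (Sig : Matrix (Plot a b) (Plot a b) ℝ) (s : BlockArray a b t) :
    Matrix (Fin t) (Fin t) ℝ := (sideMat s)ᵀ * Btilde Sig * sideMat s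

/-- `c_{s00} = tr (B_t C_{s00})`. -/
def c00 (Sig : Matrix (Plot a b) (Plot a b) ℝ) (s : BlockArray a b t) : ℝ :=
  (centering t * C00 Sig s).trace

/-- `c_{s01} = tr (B_t C_{s01})`. -/
def c01 (Sig : Matrix (Plot a b) (Plot a b) ℝ) (s : BlockArray a b t) : ℝ :=
  (centering t * C01 Sig s).trace

/-- `c_{s11} = tr (B_t C_{s11})`. -/
def c11 (Sig : Matrix (Plot a b) (Plot a b) ℝ) (s : BlockArray a b t) : ℝ :=
  (centering t * C11 Sig s).trace

/-- The quadratic function `q_s(x) = c_{s00} + 2 c_{s01} x + c_{s11} x²`. -/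
def q (Sig : Matrix (Plot a b) (Plot a b) ℝ) (s : BlockArray a b t) (x : ℝ) : ℝ :=
  c00 Sig s + 2 * c01 Sig s * x + c11 Sig s * x ^ 2

/-! ### Measures (approximate designs) -/

/-- The set `𝒫` of measures `ξ = (p_s)` on the block arrays. -/
abbrev DesignMeasure (a b t : ℕ) : Type := stdSimplex ℝ (BlockArray a b t)

/-- `q_ξ(x) = ∑ p_s q_s(x)`. -/
def qMeasure (Sig : Matrix (Plot a b) (Plot a b) ℝ) (ξ : DesignMeasure a b t) (x : ℝ) : ℝ :=
  ∑ s, ξ.1 s * q Sig s x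

/-- `q*_ξ = c_{ξ00} - c_{ξ01}² / c_{ξ11}`, where `c_{ξij} = ∑ p_s c_{sij}`. If `c_{ξ11} = 0` then
also `c_{ξ01} = 0`, and the quotient is read as `0`, so `q*_ξ` is always the minimum of `q_ξ`. -/
def qStar (Sig : Matrix (Plot a b) (Plot a b) ℝ) (ξ : DesignMeasure a b t) : ℝ :=
  (∑ s, ξ.1 s * c00 Sig s) - (∑ s, ξ.1 s * c01 Sig s) ^ 2 / (∑ s, ξ.1 s * c11 Sig s)

/-- `r(x) = max_ξ q_ξ(x)` (a maximum of a continuous function over a compact simplex). -/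
def r (a b t : ℕ) (Sig : Matrix (Plot a b) (Plot a b) ℝ) (x : ℝ) : ℝ :=
  ⨆ ξ : DesignMeasure a b t, qMeasure Sig ξ x

/-- `x` is `x*`, `y` is `y*` and `Q` is the supporting set: `x` is the unique minimizer of `r`,
`y` is the maximum of `q*_ξ` over all measures as well as the value `r(x)`, and `Q` consists of
the arrays `s` with `q_s(x) = y`. -/
structure IsOptimalTriple (Sig : Matrix (Plot a b) (Plot a b) ℝ) (x y : ℝ)
    (Q : Set (BlockArray a b t)) : Prop where
  minimizer : ∀ x' : ℝ, x' ≠ x → r a b t Sig x < r a b t Sig x'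
  value_eq : y = r a b t Sig x
  value_max : IsGreatest (Set.range fun ξ : DesignMeasure a b t => qStar Sig ξ) y
  support : Q = {s | q Sig s x = y}

/-! ### Significant treatments -/

/-- Two plots are adjacent if they are consecutive in a row or in a column. -/
def Adjacent (u v : Plot a b) : Prop :=
  (u.1 = v.1 ∧ ((u.2 : ℕ) + 1 = v.2 ∨ (v.2 : ℕ) + 1 = u.2)) ∨
  (u.2 = v.2 ∧ ((u.1 : ℕ) + 1 = v.1 ∨ (v.1 : ℕ) + 1 = u.1))

/-- A plot on a corner of the block. -/
def IsCorner (u : Plot a b) : Prop :=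
  ((u.2 : ℕ) = 0 ∨ (u.2 : ℕ) + 1 = a) ∧ ((u.1 : ℕ) = 0 ∨ (u.1 : ℕ) + 1 = b)

/-- `f_{s,m}`: the number of replications of the treatment `m` in the array `s`. -/
def replications (s : BlockArray a b t) (m : Fin t) : ℕ := {u : Plot a b | s.treat u = m}.ncard

/-- The treatment `m` appears exactly twice, in adjacent plots, at least one being a corner. -/
def IsSignificant (s : BlockArray a b t) (m : Fin t) : Prop :=
  replications s m = 2 ∧
  (∃ u v : Plot a b, s.treat u = m ∧ s.treat v = m ∧ Adjacent u v) ∧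
  ∃ u : Plot a b, s.treat u = m ∧ IsCorner u

/-- The treatment `m` is significant and all of its plots are corners. -/
def IsStrictlySignificant (s : BlockArray a b t) (m : Fin t) : Prop :=
  IsSignificant s m ∧ ∀ u : Plot a b, s.treat u = m → IsCorner u

/-- `𝒬_i`: exactly `i` treatments are significant and `ab - 2i` are replicated exactly once. -/
def QSet (a b t i : ℕ) : Set (BlockArray a b t) :=
  {s | {m : Fin t | IsSignificant s m}.ncard = i ∧
    {m : Fin t | replications s m = 1}.ncard + 2 * i = a * b}

/-- `𝒬*_j`: the arrays of `𝒬_j` whose significant treatments are all strictly significant. -/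
def QStarSet (a b t j : ℕ) : Set (BlockArray a b t) :=
  {s | s ∈ QSet a b t j ∧ ∀ m : Fin t, IsSignificant s m → IsStrictlySignificant s m}

/-- The constant `η` (with `p = ab`). -/
def eta (a b t : ℕ) : ℝ :=
  4 * (a * b) - 2 * a - 2 * b - 2 * (8 * a * b - 7 * a - 7 * b + 4) / t
    + 4 * (2 * (a * b) - a - b) ^ 2 / (a * b * t)

end Interference

end

/-! Let N be the adjacency matrix of the plots, so that F = NT. Then q_s(x) is a sum over ordered
pairs of plots (v, w) of (𝟙[same treatment] - 1/t) K_x(v, w), where K_x = (I + xN) B_p (I + xN)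
(`q_one_eq`). The diagonal and the 1/t terms do not depend on s. Hence q_s(x) equals its value for
distinct treatments plus the sum of K_x over the repeated pairs (`q_one_eq_distinctQ_add`).

The point x* is the smaller root of K_x(v, w) = 0 for the most favourable pairs: a corner and a
neighbour if a ≥ 3, two adjacent corners if a = 2. At x* every other off-diagonal entry is negative.
So y* is the value for distinct treatments, and equality holds exactly when all repetitions occur on
favourable pairs (`q_one_le_and_eq_iff`). As the plot graph has no triangles, such a treatment
occurs at most twice, which identifies the equality set with the unions of 𝒬_i or 𝒬*_j.

Optimality of x* is a saddle-point argument (`isOptimalTriple_of_measure`): it suffices to find a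
measure on maximizing arrays whose mean quadratic is strictly convex and stationary at x*. An array
with distinct treatments has nonpositive slope there. Either that slope is zero (the 2 × 2 block),
or an array with two significant treatments has positive slope, and the two can be mixed
(`isOptimalTriple_of_kernel`). -/

noncomputable section

namespace Interference

variable {a b t : ℕ}

/-! ### The interference kernel -/

/-- The adjacency matrix of the plots of a block. -/
def neighborMat (a b : ℕ) : Matrix (Plot a b) (Plot a b) ℝ :=
  (1 : Matrix (Fin b) (Fin b) ℝ) ⊗ₖ shiftK a + (1 : Matrix (Fin b) (Fin b) ℝ) ⊗ₖ (shiftK a)ᵀ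
    + shiftK b ⊗ₖ (1 : Matrix (Fin a) (Fin a) ℝ) + (shiftK b)ᵀ ⊗ₖ (1 : Matrix (Fin a) (Fin a) ℝ)

theorem sideMat_eq (s : BlockArray a b t) : sideMat s = neighborMat a b * directMat s := by
  simp only [sideMat, neighborMat, Matrix.add_mul]

theorem neighborMat_transpose : (neighborMat a b)ᵀ = neighborMat a b := by
  simp only [neighborMat, Matrix.transpose_add, ← Matrix.kroneckerMap_transpose,
    Matrix.transpose_one, Matrix.transpose_transpose]
  abel

open scoped Classical in
theorem neighborMat_apply (v w : Plot a b) :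
    neighborMat a b v w = if Adjacent v w then 1 else 0 := by
  obtain ⟨j, i⟩ := v
  obtain ⟨l, k⟩ := w
  simp only [neighborMat, Matrix.add_apply, Matrix.kroneckerMap_apply, Matrix.one_apply, shiftK,
    Matrix.of_apply, Matrix.transpose_apply, Adjacent, Fin.ext_iff]
  split_ifs <;> first | omega | norm_num

/-- The number of neighbours of a point on a line of `h` points. -/
def lineDegree (h i : ℕ) : ℕ := (if i = 0 then 0 else 1) + (if i + 1 = h then 0 else 1)

/-- The number of neighbours of a plot. -/
def plotDegree (u : Plot a b) : ℕ := lineDegree b u.1 + lineDegree a u.2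

theorem sum_shiftK_row {h : ℕ} (i : Fin h) :
    ∑ j, shiftK h i j = if (i : ℕ) = 0 then 0 else 1 := by
  simp only [shiftK, Matrix.of_apply]
  split_ifs with hi
  · exact Finset.sum_eq_zero fun j _ => if_neg (by omega)
  · rw [Finset.sum_eq_single (⟨i - 1, by omega⟩ : Fin h)]
    · exact if_pos (by simp only; omega)
    · intro j _ hj
      exact if_neg fun h => hj (Fin.ext (by simp only; omega))
    · simp

theorem sum_shiftK_col {h : ℕ} (i : Fin h) :
    ∑ j, shiftK h j i = if (i : ℕ) + 1 = h then 0 else 1 := by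
  simp only [shiftK, Matrix.of_apply]
  split_ifs with hi
  · exact Finset.sum_eq_zero fun j _ => if_neg (by omega)
  · rw [Finset.sum_eq_single (⟨i + 1, by omega⟩ : Fin h)]
    · exact if_pos (by simp only)
    · intro j _ hj
      exact if_neg fun h => hj (Fin.ext (by simp only; omega))
    · simp

theorem sum_kronecker {α β : Type} [Fintype α] [Fintype β] (A : Matrix α α ℝ) (B : Matrix β β ℝ)
    (v : α × β) : ∑ w, (A ⊗ₖ B) v w = (∑ l, A v.1 l) * ∑ k, B v.2 k := by
  rw [Fintype.sum_prod_type, Finset.sum_mul_sum]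
  rfl

theorem sum_neighborMat (v : Plot a b) : ∑ w, neighborMat a b v w = plotDegree v := by
  have h1 : ∀ {h : ℕ} (i : Fin h), ∑ j, (1 : Matrix (Fin h) (Fin h) ℝ) i j = 1 := by
    intro h i
    simp [Matrix.one_apply]
  simp only [neighborMat, Matrix.add_apply, Finset.sum_add_distrib, sum_kronecker, h1,
    Matrix.transpose_apply, sum_shiftK_row, sum_shiftK_col, plotDegree, lineDegree]
  push_cast
  ring

theorem neighborMat_symm (v w : Plot a b) : neighborMat a b v w = neighborMat a b w v := by
  conv_lhs => rw [← neighborMat_transpose, Matrix.transpose_apply]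

theorem sum_neighborMat' (v : Plot a b) : ∑ w, neighborMat a b w v = plotDegree v := by
  rw [← sum_neighborMat]
  exact Finset.sum_congr rfl fun w _ => neighborMat_symm _ _

theorem Btilde_one : Btilde (1 : Matrix (Plot a b) (Plot a b) ℝ)
    = 1 - ((a : ℝ) * b)⁻¹ • allOnes (Plot a b) := by
  simp [Btilde, dotProduct, mul_comm]

/-- The quadratic form `tr (B_t T' X T)` as a sum over pairs of plots. -/
theorem trace_centering_mul (s : BlockArray a b t) (X : Matrix (Plot a b) (Plot a b) ℝ) :
    (centering t * ((directMat s)ᵀ * X * directMat s)).trace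
      = ∑ v, ∑ w, ((if s.treat v = s.treat w then 1 else 0) - (t : ℝ)⁻¹) * X v w := by
  have key : ∀ m n, ((directMat s)ᵀ * X * directMat s) m n
      = ∑ v, ∑ w, (if s.treat v = m then 1 else 0) * (if s.treat w = n then 1 else 0) * X v w := by
    intro m n
    simp only [Matrix.mul_apply, Matrix.transpose_apply, directMat, Matrix.of_apply,
      Finset.sum_mul]
    rw [Finset.sum_comm]
    exact Finset.sum_congr rfl fun v _ => Finset.sum_congr rfl fun w _ => by ring
  have h1 : ((directMat s)ᵀ * X * directMat s).trace
      = ∑ v, ∑ w, (if s.treat v = s.treat w then 1 else 0) * X v w := by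
    simp only [Matrix.trace, Matrix.diag_apply, key]
    rw [Finset.sum_comm]
    refine Finset.sum_congr rfl fun v _ => ?_
    rw [Finset.sum_comm]
    refine Finset.sum_congr rfl fun w _ => ?_
    rw [← Finset.sum_mul]
    congr 1
    simp [eq_comm]
  have h2 : (allOnes (Fin t) * ((directMat s)ᵀ * X * directMat s)).trace
      = ∑ v, ∑ w, X v w := by
    have hJ : ∀ (Y : Matrix (Fin t) (Fin t) ℝ) m,
        (allOnes (Fin t) * Y) m m = ∑ n, Y n m := fun Y m => by
      rw [Matrix.mul_apply]; simp [allOnes]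
    simp only [Matrix.trace, Matrix.diag_apply, hJ, key]
    simp_rw [Finset.sum_comm (s := (Finset.univ : Finset (Fin t)))
      (t := (Finset.univ : Finset (Plot a b)))]
    refine Finset.sum_congr rfl fun v _ => ?_
    refine Finset.sum_congr rfl fun w _ => ?_
    simp
  rw [centering, Matrix.sub_mul, Matrix.one_mul, Matrix.trace_sub, Matrix.smul_mul,
    Matrix.trace_smul, h1, h2, smul_eq_mul, Finset.mul_sum, ← Finset.sum_sub_distrib]
  refine Finset.sum_congr rfl fun v _ => ?_
  rw [Finset.mul_sum, ← Finset.sum_sub_distrib]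
  exact Finset.sum_congr rfl fun w _ => by ring

/-- The matrix `(I + x N) B_p (I + x N)`, entry by entry. -/
def pairKernel (x : ℝ) (v w : Plot a b) : ℝ :=
  (if v = w then 1 else 0) + 2 * x * neighborMat a b v w
    + x ^ 2 * (neighborMat a b * neighborMat a b) v w
    - (1 + x * plotDegree v) * (1 + x * plotDegree w) / (a * b)

/-- Expanding the product gives the cross terms BN and NB instead of 2BN. They are transposes of
each other and have the same trace, since the weight on pairs of plots is symmetric. -/
theorem q_one_eq_trace (s : BlockArray a b t) (x : ℝ) :
    q 1 s x = (centering t * ((directMat s)ᵀ * ((1 + x • neighborMat a b)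
      * Btilde (1 : Matrix (Plot a b) (Plot a b) ℝ) * (1 + x • neighborMat a b))
        * directMat s)).trace := by
  set N := neighborMat a b with hN
  set B := Btilde (1 : Matrix (Plot a b) (Plot a b) ℝ) with hB
  have hBt : Bᵀ = B := by
    rw [hB, Btilde_one]
    ext v w
    simp [allOnes, Matrix.one_apply, eq_comm]
  have hswap : ∑ v, ∑ w, ((if s.treat v = s.treat w then 1 else 0) - (t : ℝ)⁻¹) * (N * B) v w
      = ∑ v, ∑ w, ((if s.treat v = s.treat w then 1 else 0) - (t : ℝ)⁻¹) * (B * N) v w := by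
    rw [Finset.sum_comm]
    refine Finset.sum_congr rfl fun v _ => Finset.sum_congr rfl fun w _ => ?_
    have h : (N * B) w v = (B * N) v w := by
      rw [← Matrix.transpose_apply (N * B), Matrix.transpose_mul, hBt, hN, neighborMat_transpose]
    rw [h]
    simp only [eq_comm]
  have h01 : C01 1 s = (directMat s)ᵀ * (B * N) * directMat s := by
    rw [C01, sideMat_eq]; simp only [Matrix.mul_assoc, hB, hN]
  have h11 : C11 1 s = (directMat s)ᵀ * (N * B * N) * directMat s := by
    rw [C11, sideMat_eq, Matrix.transpose_mul, neighborMat_transpose]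
    simp only [Matrix.mul_assoc, hB, hN]
  have hexp : (1 + x • N) * B * (1 + x • N) = B + x • (B * N) + x • (N * B) + x ^ 2 • (N * B * N) := by
    simp only [Matrix.add_mul, Matrix.mul_add, Matrix.one_mul, Matrix.mul_one, Matrix.smul_mul,
      Matrix.mul_smul, smul_smul, smul_add, sq]
    abel
  rw [q, c00, c01, c11, h01, h11, C00, ← hB, hexp]
  simp only [trace_centering_mul, Matrix.add_apply, Matrix.smul_apply, smul_eq_mul, mul_add,
    Finset.sum_add_distrib]
  simp only [mul_left_comm _ x, mul_left_comm _ (x ^ 2), ← Finset.mul_sum, hswap]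
  ring

theorem kernel_apply (x : ℝ) (v w : Plot a b) :
    ((1 + x • neighborMat a b) * Btilde (1 : Matrix (Plot a b) (Plot a b) ℝ)
      * (1 + x • neighborMat a b)) v w = pairKernel x v w := by
  have hrow : ∀ v, ∑ u, (1 + x • neighborMat a b) v u = 1 + x * plotDegree v := by
    intro v
    simp only [Matrix.add_apply, Matrix.smul_apply, smul_eq_mul, Finset.sum_add_distrib,
      ← Finset.mul_sum, sum_neighborMat, Matrix.one_apply, Finset.sum_ite_eq, Finset.mem_univ,
      if_true]
  have hcol : ∀ v, ∑ u, (1 + x • neighborMat a b) u v = 1 + x * plotDegree v := by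
    intro v
    simp only [Matrix.add_apply, Matrix.smul_apply, smul_eq_mul, Finset.sum_add_distrib,
      ← Finset.mul_sum, sum_neighborMat', Matrix.one_apply, Finset.sum_ite_eq', Finset.mem_univ,
      if_true]
  have hJ : ((1 + x • neighborMat a b) * allOnes (Plot a b) * (1 + x • neighborMat a b)) v w
      = (1 + x * plotDegree v) * (1 + x * plotDegree w) := by
    rw [← hrow v, ← hcol w, Finset.mul_sum, Matrix.mul_apply]
    refine Finset.sum_congr rfl fun u _ => ?_
    rw [Matrix.mul_apply]
    simp [allOnes]
  rw [Btilde_one, Matrix.mul_sub, Matrix.mul_one, Matrix.sub_mul, Matrix.mul_smul,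
    Matrix.smul_mul, Matrix.sub_apply, Matrix.smul_apply, hJ, pairKernel]
  simp only [Matrix.add_mul, Matrix.mul_add, Matrix.one_mul, Matrix.mul_one, Matrix.smul_mul,
      Matrix.mul_smul, Matrix.add_apply, Matrix.smul_apply, smul_eq_mul, Matrix.one_apply]
  ring

theorem q_one_eq (s : BlockArray a b t) (x : ℝ) :
    q 1 s x = ∑ v, ∑ w, ((if s.treat v = s.treat w then 1 else 0) - (t : ℝ)⁻¹)
      * pairKernel x v w := by
  rw [q_one_eq_trace, trace_centering_mul]
  simp only [kernel_apply]

/-! ### Nonnegativity of the quadratics -/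

theorem one_sub_smul_allOnes_eq {ι : Type} [Fintype ι] [DecidableEq ι] (c : ℝ)
    (hc : c * Fintype.card ι = 1) : 
    (1 - c • allOnes ι : Matrix ι ι ℝ) = (1 - c • allOnes ι)ᴴ * (1 - c • allOnes ι) := by
  have hJ : allOnes ι * allOnes ι = (Fintype.card ι : ℝ) • allOnes ι := by
    ext; simp [allOnes, Matrix.mul_apply]
  have hT : (1 - c • allOnes ι : Matrix ι ι ℝ)ᴴ = 1 - c • allOnes ι := by
    ext i j; simp [allOnes, Matrix.one_apply, eq_comm]
  rw [hT]
  simp only [Matrix.mul_sub, Matrix.sub_mul, Matrix.one_mul, Matrix.mul_one, Matrix.smul_mul,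
    Matrix.mul_smul, hJ, smul_smul, hc, one_smul]
  simp

/-- With Y = B_p (I + xN) T the value is tr(B_t Y'Y), and both centering matrices are symmetric
idempotents, hence Gram matrices. -/
theorem q_one_nonneg (hp : 0 < a * b) (s : BlockArray a b t) (x : ℝ) : 0 ≤ q 1 s x := by
  have ht : (t : ℝ) ≠ 0 := by
    rintro h
    have : t = 0 := by exact_mod_cast h
    subst this
    exact (s ⟨0, Nat.pos_of_mul_pos_right hp⟩ ⟨0, Nat.pos_of_mul_pos_left hp⟩).elim0
  have hp' : (a : ℝ) * b ≠ 0 := by exact_mod_cast hp.ne'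
  have hB := one_sub_smul_allOnes_eq (ι := Plot a b) ((a : ℝ) * b)⁻¹ (by
    simp only [Fintype.card_prod, Fintype.card_fin]
    push_cast
    rw [mul_comm (b : ℝ)]
    exact inv_mul_cancel₀ hp')
  have hC : (centering t).PosSemidef := by
    rw [centering, one_sub_smul_allOnes_eq _ (by simp [ht])]
    exact Matrix.posSemidef_conjTranspose_mul_self _
  have hA : (1 + x • neighborMat a b)ᴴ = 1 + x • neighborMat a b := by
    rw [Matrix.conjTranspose_eq_transpose_of_trivial, Matrix.transpose_add, Matrix.transpose_one,
      Matrix.transpose_smul, neighborMat_transpose]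
  set Y := (1 - ((a : ℝ) * b)⁻¹ • allOnes (Plot a b)) * (1 + x • neighborMat a b) * directMat s
    with hY
  have hX : (directMat s)ᵀ * ((1 + x • neighborMat a b)
      * Btilde (1 : Matrix (Plot a b) (Plot a b) ℝ) * (1 + x • neighborMat a b))
        * directMat s = Yᴴ * Y := by
    rw [Btilde_one, hB, hY, Matrix.conjTranspose_mul, Matrix.conjTranspose_mul, hA,
      Matrix.conjTranspose_eq_transpose_of_trivial (directMat s)]
    simp only [Matrix.mul_assoc]
  rw [q_one_eq_trace, hX, ← Matrix.mul_assoc, Matrix.trace_mul_comm, ← Matrix.mul_assoc]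
  exact (hC.mul_mul_conjTranspose_same Y).trace_nonneg

/-! ### Optimality from a stationary mixture -/

section Optimality

variable {Sig : Matrix (Plot a b) (Plot a b) ℝ}

theorem qMeasure_eq (ξ : DesignMeasure a b t) (x : ℝ) :
    qMeasure Sig ξ x = (∑ s, ξ.1 s * c00 Sig s) + 2 * (∑ s, ξ.1 s * c01 Sig s) * x
      + (∑ s, ξ.1 s * c11 Sig s) * x ^ 2 := by
  simp only [qMeasure, q, Finset.mul_sum, Finset.sum_mul, ← Finset.sum_add_distrib]
  exact Finset.sum_congr rfl fun s _ => by ring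

theorem qMeasure_le {x y : ℝ} (hle : ∀ s : BlockArray a b t, q Sig s x ≤ y) (ξ : DesignMeasure a b t) :
    qMeasure Sig ξ x ≤ y := by
  calc qMeasure Sig ξ x ≤ ∑ s, ξ.1 s * y :=
        Finset.sum_le_sum fun s _ => mul_le_mul_of_nonneg_left (hle s) (ξ.2.1 s)
    _ = y := by rw [← Finset.sum_mul, ξ.2.2, one_mul]

theorem qMeasure_le_r (ξ : DesignMeasure a b t) (x : ℝ) :
    qMeasure Sig ξ x ≤ r a b t Sig x := by
  refine le_ciSup (f := fun ξ : DesignMeasure a b t => qMeasure Sig ξ x) ?_ ξ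
  -- A real supremum is meaningful only for a bounded family; this crude bound suffices.
  refine ⟨∑ s : BlockArray a b t, |q Sig s x|, ?_⟩
  rintro _ ⟨ζ, rfl⟩
  exact qMeasure_le (fun s => (le_abs_self _).trans
    (Finset.single_le_sum (f := fun s => |q Sig s x|) (fun _ _ => abs_nonneg _)
      (Finset.mem_univ s))) ζ

/-- A quadratic that is nowhere negative has a nonnegative leading coefficient, and no linear
term if the leading coefficient vanishes. -/
theorem quadratic_coeffs_of_nonneg {α β γ : ℝ} (h : ∀ x : ℝ, 0 ≤ α + 2 * β * x + γ * x ^ 2) :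
    0 ≤ γ ∧ (γ = 0 → β = 0) := by
  have hd : (2 * β) ^ 2 - 4 * γ * α ≤ 0 := by
    have := discrim_le_zero (a := γ) (b := 2 * β) (c := α) fun x => by nlinarith [h x]
    simpa [discrim] using this
  refine ⟨?_, fun h0 => ?_⟩
  · by_contra! hγ
    have hα : 0 ≤ α := by simpa using h 0
    have hα0 : α = 0 := by nlinarith [mul_nonneg hα (neg_nonneg.2 hγ.le), sq_nonneg β]
    have h1 := h 1
    have h2 := h (-1)
    rw [hα0] at h1 h2
    nlinarith
  · rw [h0] at hd
    have : β ^ 2 = 0 := le_antisymm (by nlinarith) (sq_nonneg β)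
    exact pow_eq_zero_iff (two_ne_zero) |>.1 this

theorem qStar_le_qMeasure (hnn : ∀ (s : BlockArray a b t) (x : ℝ), 0 ≤ q Sig s x)
    (ξ : DesignMeasure a b t) (x : ℝ) : qStar Sig ξ ≤ qMeasure Sig ξ x := by
  have hq : ∀ x, 0 ≤ qMeasure Sig ξ x := fun x =>
    Finset.sum_nonneg fun s _ => mul_nonneg (ξ.2.1 s) (hnn s x)
  simp only [qMeasure_eq] at hq
  obtain ⟨h1, h2⟩ := quadratic_coeffs_of_nonneg hq
  clear hq
  rw [qMeasure_eq, qStar]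
  generalize ∑ s, ξ.1 s * c00 Sig s = α
  generalize ∑ s, ξ.1 s * c01 Sig s = β at h2 ⊢
  generalize ∑ s, ξ.1 s * c11 Sig s = γ at h1 h2 ⊢
  rcases h1.eq_or_lt with h0 | hpos
  -- If the leading coefficient vanishes, so does the linear one, and division by zero gives the
  -- intended quotient 0.
  · simp [← h0, h2 h0.symm]
  · have : α + 2 * β * x + γ * x ^ 2 - (α - β ^ 2 / γ) = (β + γ * x) ^ 2 / γ := by
      field_simp
      ring
    have h3 : 0 ≤ (β + γ * x) ^ 2 / γ := by positivity
    linarith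

/-- The quadratic of ξ is a strict parabola with vertex x, so r(x') ≥ q_ξ(x') > q_ξ(x) = y for x' ≠
x. Conversely q*_ζ ≤ q_ζ(x) ≤ y for every ζ, with equality at ξ. -/
theorem isOptimalTriple_of_measure (hnn : ∀ (s : BlockArray a b t) (x : ℝ), 0 ≤ q Sig s x)
    {x y : ℝ} (hle : ∀ s : BlockArray a b t, q Sig s x ≤ y) (ξ : DesignMeasure a b t)
    (hξ : qMeasure Sig ξ x = y) (hpos : 0 < ∑ s, ξ.1 s * c11 Sig s)
    (hstat : (∑ s, ξ.1 s * c01 Sig s) + (∑ s, ξ.1 s * c11 Sig s) * x = 0) :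
    IsOptimalTriple Sig x y {s : BlockArray a b t | q Sig s x = y} := by
  have hr : r a b t Sig x = y := by
    have : Nonempty (DesignMeasure a b t) := ⟨ξ⟩
    exact le_antisymm (ciSup_le (qMeasure_le hle)) (hξ ▸ qMeasure_le_r ξ x)
  have hβ : ∑ s, ξ.1 s * c01 Sig s = -((∑ s, ξ.1 s * c11 Sig s) * x) := by linarith
  refine ⟨fun x' hx' => ?_, hr.symm, ⟨⟨ξ, ?_⟩, ?_⟩, rfl⟩
  · rw [hr]
    refine lt_of_lt_of_le ?_ (qMeasure_le_r ξ x')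
    rw [← hξ, qMeasure_eq, qMeasure_eq, hβ]
    have := mul_pos hpos (pow_pos (abs_pos.2 (sub_ne_zero.2 hx')) 2)
    rw [sq_abs] at this
    nlinarith
  · change qStar Sig ξ = y
    rw [← hξ, qMeasure_eq, qStar, hβ]
    field_simp
    ring
  · rintro _ ⟨ζ, rfl⟩
    exact (qStar_le_qMeasure hnn ζ x).trans (qMeasure_le hle ζ)

theorem exists_mixture (s₀ s₁ : BlockArray a b t) {l : ℝ} (h0 : 0 ≤ l) (h1 : l ≤ 1) :
    ∃ ξ : DesignMeasure a b t, ∀ f : BlockArray a b t → ℝ,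
      ∑ s, ξ.1 s * f s = l * f s₀ + (1 - l) * f s₁ := by
  have key : ∀ f : BlockArray a b t → ℝ, ∑ s, (l * (if s = s₀ then 1 else 0)
      + (1 - l) * (if s = s₁ then 1 else 0)) * f s = l * f s₀ + (1 - l) * f s₁ := by
    intro f
    simp only [add_mul, Finset.sum_add_distrib, mul_assoc, ← Finset.mul_sum, ite_mul, one_mul,
      zero_mul, Finset.sum_ite_eq', Finset.mem_univ, if_true]
  refine ⟨⟨fun s => l * (if s = s₀ then 1 else 0) + (1 - l) * (if s = s₁ then 1 else 0),
    fun s => ?_, ?_⟩, key⟩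
  · have := sub_nonneg.2 h1
    positivity
  · simpa using key fun _ => 1

theorem isOptimalTriple_of_two (hnn : ∀ (s : BlockArray a b t) (x : ℝ), 0 ≤ q Sig s x)
    {x y : ℝ} (hle : ∀ s : BlockArray a b t, q Sig s x ≤ y) (s₀ s₁ : BlockArray a b t)
    (h0 : q Sig s₀ x = y) (h1 : q Sig s₁ x = y) (hpos : 0 < c11 Sig s₀)
    (hD0 : c01 Sig s₀ + c11 Sig s₀ * x ≤ 0)
    (hD1 : c01 Sig s₀ + c11 Sig s₀ * x = 0 ∨ 0 < c01 Sig s₁ + c11 Sig s₁ * x) :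
    IsOptimalTriple Sig x y {s : BlockArray a b t | q Sig s x = y} := by
  have hc1 : 0 ≤ c11 Sig s₁ := (quadratic_coeffs_of_nonneg (hnn s₁)).1
  set D₀ := c01 Sig s₀ + c11 Sig s₀ * x with hD₀
  set D₁ := c01 Sig s₁ + c11 Sig s₁ * x with hD₁
  obtain ⟨l, hl0, hl1, hl⟩ : ∃ l : ℝ, 0 < l ∧ l ≤ 1 ∧ l * D₀ + (1 - l) * D₁ = 0 := by
    rcases hD1 with h | h
    · exact ⟨1, one_pos, le_rfl, by rw [h]; ring⟩
    -- The weight that cancels the two half-slopes; it is positive, so the mixture inherits a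
    -- positive leading coefficient from `s₀`.
    · refine ⟨D₁ / (D₁ - D₀), by apply div_pos <;> linarith,
        (div_le_one (by linarith)).2 (by linarith), ?_⟩
      have : D₁ - D₀ ≠ 0 := by linarith
      field_simp
      ring
  obtain ⟨ξ, hξ⟩ := exists_mixture s₀ s₁ hl0.le hl1
  refine isOptimalTriple_of_measure hnn hle ξ ?_ ?_ ?_
  · rw [qMeasure, hξ, h0, h1]; ring
  · rw [hξ]
    have := mul_nonneg (sub_nonneg.2 hl1) hc1
    have := mul_pos hl0 hpos
    linarith
  · rw [hξ, hξ]
    linear_combination hl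

end Optimality

/-! ### Arrays whose repeated treatments are significant -/

section Significant

theorem Adjacent.symm {u v : Plot a b} (h : Adjacent u v) : Adjacent v u := by
  unfold Adjacent at *
  grind

theorem Adjacent.ne {u v : Plot a b} (h : Adjacent u v) : u ≠ v := by
  rintro rfl
  unfold Adjacent at h
  omega

/-- The graph of the plots has no triangles. -/
theorem not_adjacent_of_adjacent {u v w : Plot a b} (h₁ : Adjacent u v) (h₂ : Adjacent v w) :
    ¬ Adjacent u w := by
  unfold Adjacent at *
  simp only [Fin.ext_iff] at *
  omega

open scoped Classical in
theorem replications_eq_card (s : BlockArray a b t) (m : Fin t) :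
    replications s m = (Finset.univ.filter fun u => s.treat u = m).card := by
  rw [replications, Set.ncard_eq_toFinset_card', Set.toFinset_ofPred]

theorem sum_replications (s : BlockArray a b t) : ∑ m, replications s m = a * b := by
  classical
  simp only [replications_eq_card]
  rw [← Finset.card_eq_sum_card_fiberwise fun _ _ => Finset.mem_coe.2 (Finset.mem_univ _)]
  simp [mul_comm]

/-- Any two plots with the same treatment are adjacent, one of them being a corner. -/
def RepeatsSignificant (s : BlockArray a b t) : Prop :=
  ∀ v w : Plot a b, v ≠ w → s.treat v = s.treat w → Adjacent v w ∧ (IsCorner v ∨ IsCorner w)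

theorem eq_or_eq_of_replications_eq_two {s : BlockArray a b t} {m : Fin t}
    (h : replications s m = 2) {u v : Plot a b} (huv : u ≠ v) (hu : s.treat u = m)
    (hv : s.treat v = m) {w : Plot a b} (hw : s.treat w = m) : w = u ∨ w = v := by
  classical
  rw [replications_eq_card] at h
  have hs : ({u, v} : Finset (Plot a b)) = Finset.univ.filter fun u => s.treat u = m := by
    refine Finset.eq_of_subset_of_card_le ?_ ?_
    · intro x hx
      rcases Finset.mem_insert.1 hx with rfl | hx
      · simpa using hu
      · rw [Finset.mem_singleton.1 hx]; simpa using hv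
    · rw [h, Finset.card_pair huv]
  have : w ∈ ({u, v} : Finset (Plot a b)) := by rw [hs]; simpa using hw
  simpa using this

/-- A third plot with the same treatment would form a triangle of pairwise adjacent plots. -/
theorem RepeatsSignificant.isSignificant {s : BlockArray a b t} (hs : RepeatsSignificant s)
    {v w : Plot a b} (hvw : v ≠ w) (h : s.treat v = s.treat w) : IsSignificant s (s.treat v) := by
  classical
  obtain ⟨hadj, hcor⟩ := hs v w hvw h
  refine ⟨?_, ⟨v, w, rfl, h.symm, hadj⟩, ?_⟩
  · rw [replications_eq_card, ← Finset.card_pair hvw]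
    congr 1
    ext u
    simp only [Finset.mem_filter, Finset.mem_univ, true_and, Finset.mem_insert,
      Finset.mem_singleton]
    constructor
    · intro hu
      by_contra! hne
      exact not_adjacent_of_adjacent (hs u v hne.1 hu).1 hadj (hs u w hne.2 (hu.trans h)).1
    · rintro (rfl | rfl)
      · rfl
      · exact h.symm
  · rcases hcor with hc | hc
    · exact ⟨v, rfl, hc⟩
    · exact ⟨w, h.symm, hc⟩

open scoped Classical in
theorem repeatsSignificant_iff (s : BlockArray a b t) : RepeatsSignificant s ↔
    ∀ m, (if IsSignificant s m then 2 else 0) + (if replications s m = 1 then 1 else 0)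
      = replications s m := by
  constructor
  · intro hs m
    by_cases hm : IsSignificant s m
    · simp [hm, hm.1]
    · have h1 : replications s m ≤ 1 := by
        rw [replications_eq_card, Finset.card_le_one]
        intro u hu v hv
        simp only [Finset.mem_filter, Finset.mem_univ, true_and] at hu hv
        by_contra hne
        exact hm (hu ▸ hs.isSignificant hne (hu.trans hv.symm))
      split_ifs <;> omega
  · intro hs v w hvw h
    have h2 : 2 ≤ replications s (s.treat v) := by
      rw [replications_eq_card, ← Finset.card_pair hvw]
      refine Finset.card_le_card fun u hu => ?_
      rcases Finset.mem_insert.1 hu with rfl | hu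
      · simp
      · rw [Finset.mem_singleton.1 hu]; simp [h]
    have hsig : IsSignificant s (s.treat v) := by
      by_contra hn
      have := hs (s.treat v)
      rw [if_neg hn] at this
      split_ifs at this <;> omega
    obtain ⟨h2, ⟨u, u', hu, hu', hadj⟩, ⟨c, hc, hcor⟩⟩ := hsig
    refine ⟨?_, ?_⟩
    · rcases eq_or_eq_of_replications_eq_two h2 hvw rfl h.symm hu with rfl | rfl <;>
      rcases eq_or_eq_of_replications_eq_two h2 hvw rfl h.symm hu' with rfl | rfl
      · exact absurd rfl hadj.ne
      · exact hadj
      · exact hadj.symm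
      · exact absurd rfl hadj.ne
    · rcases eq_or_eq_of_replications_eq_two h2 hvw rfl h.symm hc with rfl | rfl
      · exact Or.inl hcor
      · exact Or.inr hcor

/-- In `repeatsSignificant_iff` the left side never exceeds the right. Summing over treatments,
equality for each treatment is equivalent to equality of the totals, and the right total is ab. -/
theorem repeatsSignificant_iff_mem_QSet (s : BlockArray a b t) :
    RepeatsSignificant s ↔ s ∈ QSet a b t {m : Fin t | IsSignificant s m}.ncard := by
  classical
  rw [repeatsSignificant_iff, QSet, Set.mem_ofPred_eq, and_iff_right rfl,
    Set.ncard_eq_toFinset_card', Set.ncard_eq_toFinset_card', Set.toFinset_ofPred,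
    Set.toFinset_ofPred, ← sum_replications s]
  have hsum : (Finset.univ.filter fun m => replications s m = 1).card
      + 2 * (Finset.univ.filter fun m => IsSignificant s m).card
      = ∑ m, ((if IsSignificant s m then 2 else 0)
        + (if replications s m = 1 then 1 else 0)) := by
    rw [Finset.sum_add_distrib, ← Finset.sum_filter, ← Finset.sum_filter, Finset.sum_const,
      Finset.sum_const, smul_eq_mul, smul_eq_mul]
    ring
  rw [hsum, Finset.sum_eq_sum_iff_of_le]
  · simp
  · intro m _
    by_cases hm : IsSignificant s m
    · simp [hm, hm.1]
    · rw [if_neg hm]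
      split_ifs <;> omega

-- A corner is determined by which of its two coordinates vanish.
open scoped Classical in
theorem card_corners_le : (Finset.univ.filter fun u : Plot a b => IsCorner u).card ≤ 4 := by
  have := Finset.card_le_card_of_injOn (s := Finset.univ.filter fun u : Plot a b => IsCorner u)
    (t := (Finset.univ : Finset (Bool × Bool)))
    (fun u => (decide ((u.1 : ℕ) = 0), decide ((u.2 : ℕ) = 0))) (fun _ _ => by simp) (by
      rintro ⟨j, i⟩ hu ⟨l, k⟩ hv h
      replace hu : IsCorner (j, i) := by simpa using hu
      replace hv : IsCorner (l, k) := by simpa using hv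
      simp only [IsCorner] at hu hv
      simp only [Prod.mk.injEq, decide_eq_decide] at h
      simp only [Prod.mk.injEq, Fin.ext_iff]
      omega)
  simpa using this

theorem ncard_isSignificant_le (s : BlockArray a b t) :
    {m : Fin t | IsSignificant s m}.ncard ≤ 4 := by
  classical
  rw [Set.ncard_eq_toFinset_card', Set.toFinset_ofPred]
  refine (Finset.card_le_card (t := (Finset.univ.filter fun u : Plot a b => IsCorner u).image
    s.treat) ?_).trans (Finset.card_image_le.trans card_corners_le)
  intro m hm
  obtain ⟨u, hu, hc⟩ := (Finset.mem_filter.1 hm).2.2.2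
  exact Finset.mem_image.2 ⟨u, by simpa using hc, hu⟩

theorem ncard_isSignificant_le_two {s : BlockArray a b t}
    (hs : ∀ m, IsSignificant s m → IsStrictlySignificant s m) :
    {m : Fin t | IsSignificant s m}.ncard ≤ 2 := by
  classical
  rw [Set.ncard_eq_toFinset_card', Set.toFinset_ofPred]
  -- Each strictly significant treatment uses up two of the at most four corners.
  have hfib : (Finset.univ.filter fun u : Plot a b => IsSignificant s (s.treat u)).card
      = ∑ m ∈ Finset.univ.filter (fun m => IsSignificant s m), 2 := by
    rw [Finset.card_eq_sum_card_fiberwise (f := s.treat)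
      (t := Finset.univ.filter fun m => IsSignificant s m) fun u hu => by simpa using hu]
    refine Finset.sum_congr rfl fun m hm => ?_
    have hm' := (Finset.mem_filter.1 hm).2
    rw [← hm'.1, replications_eq_card, Finset.filter_filter]
    congr 1
    ext u
    simp only [Finset.mem_filter, Finset.mem_univ, true_and, and_iff_right_iff_imp]
    rintro rfl
    exact hm'
  have hle : (Finset.univ.filter fun u : Plot a b => IsSignificant s (s.treat u)).card ≤ 4 := by
    refine (Finset.card_le_card fun u hu => ?_).trans (card_corners_le (a := a) (b := b))
    simp only [Finset.mem_filter, Finset.mem_univ, true_and] at hu ⊢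
    exact (hs _ hu).2 u rfl
  rw [hfib, Finset.sum_const, smul_eq_mul] at hle
  exact Nat.le_of_mul_le_mul_right (show _ ≤ 2 * 2 from hle) two_pos

/-- The union of the classes `𝒬_i`. -/
theorem iUnion_QSet_eq :
    (⋃ i ∈ Finset.range 5, QSet a b t i) = {s | RepeatsSignificant s} := by
  ext s
  simp only [Set.mem_iUnion, Set.mem_ofPred_eq, Finset.mem_range, exists_prop]
  constructor
  · rintro ⟨i, -, hi⟩
    rw [repeatsSignificant_iff_mem_QSet, hi.1]
    exact hi
  · intro hs
    exact ⟨_, Nat.lt_succ_of_le (ncard_isSignificant_le s),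
      (repeatsSignificant_iff_mem_QSet s).1 hs⟩

/-- Any two plots with the same treatment are adjacent corners. -/
def RepeatsStrictlySignificant (s : BlockArray a b t) : Prop :=
  ∀ v w : Plot a b, v ≠ w → s.treat v = s.treat w → Adjacent v w ∧ IsCorner v ∧ IsCorner w

theorem repeatsStrictlySignificant_iff (s : BlockArray a b t) :
    RepeatsStrictlySignificant s ↔
      RepeatsSignificant s ∧ ∀ m, IsSignificant s m → IsStrictlySignificant s m := by
  constructor
  · intro hs
    refine ⟨fun v w hvw h => ⟨(hs v w hvw h).1, Or.inl (hs v w hvw h).2.1⟩, fun m hm =>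
      ⟨hm, fun u hu => ?_⟩⟩
    obtain ⟨h2, ⟨v, w, hv, hw, hadj⟩, -⟩ := hm
    obtain ⟨-, hcv, hcw⟩ := hs v w hadj.ne (hv.trans hw.symm)
    rcases eq_or_eq_of_replications_eq_two h2 hadj.ne hv hw hu with rfl | rfl
    · exact hcv
    · exact hcw
  · rintro ⟨hs, hst⟩ v w hvw h
    have := (hst _ (hs.isSignificant hvw h)).2
    exact ⟨(hs v w hvw h).1, this v rfl, this w h.symm⟩

theorem QSet_union_QStarSet_eq :
    QSet a b t 0 ∪ QStarSet a b t 1 ∪ QStarSet a b t 2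
      = {s | RepeatsStrictlySignificant s} := by
  have hzero : QSet a b t 0 = QStarSet a b t 0 := by
    ext s
    refine ⟨fun hs => ⟨hs, fun m hm => ?_⟩, fun hs => hs.1⟩
    have := (Set.ncard_eq_zero (Set.toFinite _)).1 hs.1
    exact absurd (show m ∈ {m | IsSignificant s m} from hm) (by rw [this]; simp)
  have hsub : ∀ j, ∀ s ∈ QStarSet a b t j, RepeatsStrictlySignificant s := fun j s hs => by
    rw [repeatsStrictlySignificant_iff, repeatsSignificant_iff_mem_QSet, hs.1.1]
    exact hs
  rw [hzero]
  ext s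
  simp only [Set.mem_union, Set.mem_ofPred_eq]
  constructor
  · rintro ((hs | hs) | hs) <;> exact hsub _ s hs
  · intro hs
    obtain ⟨h1, h2⟩ := (repeatsStrictlySignificant_iff s).1 hs
    rw [repeatsSignificant_iff_mem_QSet] at h1
    have h3 := ncard_isSignificant_le_two h2
    interval_cases hi : {m : Fin t | IsSignificant s m}.ncard
    · exact Or.inl (Or.inl ⟨h1, h2⟩)
    · exact Or.inl (Or.inr ⟨h1, h2⟩)
    · exact Or.inr ⟨h1, h2⟩

end Significant

/-! ### The quadratic of an array with distinct treatments -/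

section Distinct

theorem sum_lineDegree {h : ℕ} (hh : 2 ≤ h) :
    ∑ i : Fin h, (lineDegree h i : ℝ) = 2 * h - 2 ∧
      ∑ i : Fin h, (lineDegree h i : ℝ) ^ 2 = 4 * h - 6 := by
  obtain ⟨n, rfl⟩ : ∃ n, h = n + 2 := ⟨h - 2, by omega⟩
  have hmid : ∀ i : Fin n, lineDegree (n + 2) ((i.castSucc.succ : Fin (n + 2)) : ℕ) = 2 := by
    intro i
    have := i.2
    rw [lineDegree, Fin.val_succ, Fin.val_castSucc, if_neg (by omega), if_neg (by omega)]
  have h0 : lineDegree (n + 2) ((0 : Fin (n + 2)) : ℕ) = 1 := by simp [lineDegree]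
  have h1 : lineDegree (n + 2) ((Fin.last n).succ : Fin (n + 2)) = 1 := by simp [lineDegree]
  constructor
  · rw [Fin.sum_univ_succ, Fin.sum_univ_castSucc, h0, h1]
    simp only [hmid]
    simp
    ring
  · rw [Fin.sum_univ_succ, Fin.sum_univ_castSucc, h0, h1]
    simp only [hmid]
    simp
    ring

theorem sum_plotDegree (ha : 2 ≤ a) (hb : 2 ≤ b) :
    ∑ u : Plot a b, (plotDegree u : ℝ) = 4 * (a * b) - 2 * a - 2 * b := by
  simp only [plotDegree, Nat.cast_add, Fintype.sum_prod_type, Finset.sum_add_distrib,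
    Finset.sum_const, (sum_lineDegree ha).1, ← Finset.mul_sum, (sum_lineDegree hb).1, Finset.card_univ, Fintype.card_fin, nsmul_eq_mul]
  ring

theorem sum_plotDegree_sq (ha : 2 ≤ a) (hb : 2 ≤ b) :
    ∑ u : Plot a b, (plotDegree u : ℝ) ^ 2 = 16 * (a * b) - 14 * a - 14 * b + 8 := by
  simp only [plotDegree, Nat.cast_add, Fintype.sum_prod_type, add_sq, Finset.sum_add_distrib,
    Finset.sum_const, (sum_lineDegree ha).1, (sum_lineDegree ha).2, ← Finset.mul_sum,
    ← Finset.sum_mul, (sum_lineDegree hb).1, (sum_lineDegree hb).2,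
    Finset.card_univ, Fintype.card_fin, nsmul_eq_mul]
  ring

theorem neighborMat_sq_diag (v : Plot a b) :
    (neighborMat a b * neighborMat a b) v v = plotDegree v := by
  rw [Matrix.mul_apply, ← sum_neighborMat]
  refine Finset.sum_congr rfl fun u _ => ?_
  rw [neighborMat_symm u v, neighborMat_apply]
  split_ifs <;> simp

theorem sum_neighborMat_sq (v : Plot a b) : ∑ w, (neighborMat a b * neighborMat a b) v w
    = ∑ u, neighborMat a b v u * plotDegree u := by
  simp only [Matrix.mul_apply]
  rw [Finset.sum_comm]
  simp only [← Finset.mul_sum, sum_neighborMat]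

/-- Only x² survives: with d the degree vector, (I + xN)𝟙 = 𝟙 + xd, and B_p annihilates 𝟙, leaving
x² d'B_p d. -/
theorem sum_pairKernel (hp : (a : ℝ) * b ≠ 0) (x : ℝ) :
    ∑ v : Plot a b, ∑ w, pairKernel x v w = x ^ 2 *
      (∑ u : Plot a b, (plotDegree u : ℝ) ^ 2 - (∑ u : Plot a b, (plotDegree u : ℝ)) ^ 2 / (a * b))
      := by
  have h2 : ∑ v : Plot a b, ∑ u, neighborMat a b v u * plotDegree u
      = ∑ u : Plot a b, (plotDegree u : ℝ) ^ 2 := by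
    rw [Finset.sum_comm]
    simp only [← Finset.sum_mul, sum_neighborMat', sq]
  have hw : ∑ v : Plot a b, (1 + x * plotDegree v)
      = a * b + x * ∑ v : Plot a b, (plotDegree v : ℝ) := by
    rw [Finset.sum_add_distrib, ← Finset.mul_sum]
    simp [mul_comm]
  simp only [pairKernel, Finset.sum_sub_distrib, Finset.sum_add_distrib, ← Finset.mul_sum,
    ← Finset.sum_div, sum_neighborMat, sum_neighborMat_sq, h2, ← Finset.sum_mul, hw,
    Finset.sum_ite_eq, Finset.mem_univ, if_true]
  simp only [Finset.sum_const, Finset.card_univ, Fintype.card_prod, Fintype.card_fin, nsmul_eq_mul]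
  push_cast
  obtain ⟨ha, hb⟩ := mul_ne_zero_iff.1 hp
  field_simp
  ring

theorem sum_pairKernel_diag (hp : (a : ℝ) * b ≠ 0) (x : ℝ) :
    ∑ v : Plot a b, pairKernel x v v
      = (a * b - 1) + 2 * (-(∑ u : Plot a b, (plotDegree u : ℝ)) / (a * b)) * x
        + (∑ u : Plot a b, (plotDegree u : ℝ)
            - (∑ u : Plot a b, (plotDegree u : ℝ) ^ 2) / (a * b)) * x ^ 2 := by
  have hN : ∀ v : Plot a b, neighborMat a b v v = 0 := fun v => by
    rw [neighborMat_apply, if_neg fun h => h.ne rfl]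
  have h : ∀ v : Plot a b, pairKernel x v v = (1 - 1 / (a * b)) + (x ^ 2 - 2 * x / (a * b))
      * plotDegree v - x ^ 2 / (a * b) * (plotDegree v : ℝ) ^ 2 := fun v => by
    rw [pairKernel, hN, neighborMat_sq_diag, if_pos rfl]
    ring
  simp only [h, Finset.sum_sub_distrib, Finset.sum_add_distrib, ← Finset.mul_sum,
    Finset.sum_const, Finset.card_univ, Fintype.card_prod, Fintype.card_fin, nsmul_eq_mul]
  push_cast
  obtain ⟨ha, hb⟩ := mul_ne_zero_iff.1 hp
  field_simp
  ring

/-- `c_{s11}` for an array `s` with distinct treatments. -/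
def distinctC11 (a b t : ℕ) : ℝ :=
  eta a b t - (16 * (a * b) - 14 * a - 14 * b + 8) / (a * b)

/-- `q_s(x)` for an array `s` with distinct treatments. -/
def distinctQ (a b t : ℕ) (x : ℝ) : ℝ :=
  (a * b - 1) + 2 * (-(4 * (a * b) - 2 * a - 2 * b) / (a * b)) * x + distinctC11 a b t * x ^ 2

open scoped Classical in
theorem q_one_eq_distinctQ_add (ha : 2 ≤ a) (hb : 2 ≤ b) (s : BlockArray a b t) (x : ℝ) :
    q 1 s x = distinctQ a b t x
      + ∑ v, ∑ w, if v ≠ w ∧ s.treat v = s.treat w then pairKernel x v w else 0 := by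
  have ha' : (a : ℝ) ≠ 0 := by positivity
  have hb' : (b : ℝ) ≠ 0 := by positivity
  have hp := mul_ne_zero ha' hb'
  have hsplit : ∀ v w, ((if s.treat v = s.treat w then 1 else 0) - (t : ℝ)⁻¹) * pairKernel x v w
      = (if v = w then pairKernel x v v else 0)
        + (if v ≠ w ∧ s.treat v = s.treat w then pairKernel x v w else 0)
        - (t : ℝ)⁻¹ * pairKernel x v w := by
    intro v w
    by_cases h : v = w
    · subst h; simp; ring
    · by_cases h' : s.treat v = s.treat w <;> (simp [h, h']; try ring)
  simp only [q_one_eq, hsplit, Finset.sum_sub_distrib, Finset.sum_add_distrib, ← Finset.mul_sum,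
    Finset.sum_ite_eq, Finset.mem_univ, if_true, sum_pairKernel hp, sum_pairKernel_diag hp,
    sum_plotDegree ha hb, sum_plotDegree_sq ha hb, distinctQ, distinctC11, eta]
  field_simp
  ring

theorem coeffs_of_q_eq {Sig : Matrix (Plot a b) (Plot a b) ℝ} {s : BlockArray a b t} {α β γ : ℝ}
    (h : ∀ x, q Sig s x = α + 2 * β * x + γ * x ^ 2) : c01 Sig s = β ∧ c11 Sig s = γ := by
  have h0 := h 0
  have h1 := h 1
  have h2 := h (-1)
  simp only [q] at h0 h1 h2
  constructor <;> linarith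

end Distinct

/-! ### Signs of the kernel -/

section Sign

theorem one_le_lineDegree {h : ℕ} (hh : 2 ≤ h) (i : ℕ) : 1 ≤ lineDegree h i := by
  unfold lineDegree
  split_ifs <;> omega

theorem lineDegree_le (h i : ℕ) : lineDegree h i ≤ 2 := by
  unfold lineDegree
  split_ifs <;> omega

theorem isCorner_iff (ha : 2 ≤ a) (hb : 2 ≤ b) (u : Plot a b) :
    IsCorner u ↔ plotDegree u = 2 := by
  unfold IsCorner plotDegree lineDegree
  split_ifs <;> omega

/-- Adjacent plots have no common neighbour, so the N² entry vanishes. -/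
theorem pairKernel_of_adjacent (x : ℝ) {v w : Plot a b} (h : Adjacent v w) :
    pairKernel x v w
      = 2 * x - (1 + x * plotDegree v) * (1 + x * plotDegree w) / (a * b) := by
  have hsq : (neighborMat a b * neighborMat a b) v w = 0 := by
    rw [Matrix.mul_apply]
    refine Finset.sum_eq_zero fun u _ => ?_
    rw [neighborMat_apply, neighborMat_apply]
    split_ifs with h1 h2
    · exact absurd h (not_adjacent_of_adjacent h1 h2)
    all_goals simp
  rw [pairKernel, hsq, neighborMat_apply, if_pos h, if_neg h.ne]
  ring

theorem pairKernel_neg_of_not_adjacent {x : ℝ} {v w : Plot a b} (hvw : v ≠ w)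
    (h : ¬ Adjacent v w) (hp : 0 < (a : ℝ) * b)
    (hle : x ^ 2 * (a * b) * plotDegree v < (1 + x * plotDegree v) * (1 + x * plotDegree w)) :
    pairKernel x v w < 0 := by
  -- The entry counts common neighbours, which are among the neighbours of `v`.
  have hsq : (neighborMat a b * neighborMat a b) v w ≤ plotDegree v := by
    rw [Matrix.mul_apply, ← sum_neighborMat]
    refine Finset.sum_le_sum fun u _ => ?_
    rw [neighborMat_apply, neighborMat_apply]
    split_ifs <;> simp
  rw [pairKernel, neighborMat_apply, if_neg h, if_neg hvw, mul_zero, zero_add, zero_add, sub_neg,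
    lt_div_iff₀ hp]
  nlinarith [mul_le_mul_of_nonneg_left hsq (mul_nonneg (sq_nonneg x) hp.le)]

/-- The optimality criterion: the kernel is nonpositive off the diagonal. -/
theorem q_one_le_and_eq_iff (ha : 2 ≤ a) (hb : 2 ≤ b) {x : ℝ} {Good : Plot a b → Plot a b → Prop}
    (h0 : ∀ v w : Plot a b, v ≠ w → Good v w → pairKernel x v w = 0)
    (h1 : ∀ v w : Plot a b, v ≠ w → ¬ Good v w → pairKernel x v w < 0) (s : BlockArray a b t) :
    q 1 s x ≤ distinctQ a b t x ∧ (q 1 s x = distinctQ a b t x ↔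
      ∀ v w, v ≠ w → s.treat v = s.treat w → Good v w) := by
  classical
  have hle : ∀ v w, (if v ≠ w ∧ s.treat v = s.treat w then pairKernel x v w else 0) ≤ 0 := by
    intro v w
    split_ifs with h
    · by_cases hg : Good v w
      · exact (h0 v w h.1 hg).le
      · exact (h1 v w h.1 hg).le
    · exact le_rfl
  rw [q_one_eq_distinctQ_add ha hb]
  refine ⟨by linarith [Finset.sum_nonpos fun v (_ : v ∈ Finset.univ) =>
    Finset.sum_nonpos fun w (_ : w ∈ Finset.univ) => hle v w], ?_⟩
  rw [add_eq_left, Finset.sum_eq_zero_iff_of_nonpos fun v _ => Finset.sum_nonpos fun w _ => hle v w]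
  simp only [Finset.mem_univ, true_imp_iff, Finset.sum_eq_zero_iff_of_nonpos fun w _ => hle _ w]
  refine forall₂_congr fun v w => ?_
  constructor
  · intro h hvw hs
    rw [if_pos ⟨hvw, hs⟩] at h
    by_contra hg
    exact (h1 v w hvw hg).ne h
  · intro h
    split_ifs with hc
    · exact h0 v w hc.1 (h hc.1 hc.2)
    · rfl

end Sign

/-! ### Two arrays -/

section Arrays

/-- An array with distinct treatments. -/
def distinctArray (e : Plot a b ↪ Fin t) : BlockArray a b t := fun i j => e (j, i)

theorem distinctArray_ne (e : Plot a b ↪ Fin t) {v w : Plot a b} (h : v ≠ w) :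
    (distinctArray e).treat v ≠ (distinctArray e).treat w := fun hs => h (e.injective hs)

theorem q_distinctArray (ha : 2 ≤ a) (hb : 2 ≤ b) (e : Plot a b ↪ Fin t) (x : ℝ) :
    q 1 (distinctArray e) x = distinctQ a b t x := by
  rw [q_one_eq_distinctQ_add ha hb, add_eq_left]
  refine Finset.sum_eq_zero fun v _ => Finset.sum_eq_zero fun w _ => if_neg fun h => ?_
  exact distinctArray_ne e h.1 h.2

/-- An array in which the first two plots of the first column share a treatment, as do those of
the last column, and in which there are no other repetitions. -/
def pairedArray (e : Plot a b ↪ Fin t) : BlockArray a b t := fun i j =>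
  if (i : ℕ) = 1 ∧ ((j : ℕ) = 0 ∨ (j : ℕ) + 1 = b) then e (j, ⟨0, i.pos⟩) else e (j, i)

theorem pairedArray_eq_iff (e : Plot a b ↪ Fin t) (v w : Plot a b) :
    v ≠ w ∧ (pairedArray e).treat v = (pairedArray e).treat w ↔
      v.1 = w.1 ∧ ((v.1 : ℕ) = 0 ∨ (v.1 : ℕ) + 1 = b) ∧
        ((v.2 : ℕ) = 0 ∧ (w.2 : ℕ) = 1 ∨ (v.2 : ℕ) = 1 ∧ (w.2 : ℕ) = 0) := by
  obtain ⟨j, i⟩ := v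
  obtain ⟨l, k⟩ := w
  simp only [BlockArray.treat, pairedArray]
  split_ifs <;> simp only [e.injective.eq_iff, ne_eq, Prod.mk.injEq, Fin.ext_iff] <;> omega

theorem pairedArray_pair (e : Plot a b ↪ Fin t) {v w : Plot a b} (hvw : v ≠ w)
    (h : (pairedArray e).treat v = (pairedArray e).treat w) :
    Adjacent v w ∧ (IsCorner v ∨ IsCorner w) := by
  have := (pairedArray_eq_iff e v w).1 ⟨hvw, h⟩
  unfold Adjacent IsCorner
  simp only [Fin.ext_iff] at *
  omega

/-- Two repeated treatments give four ordered pairs, each joining a corner of degree 2 to the plot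
below it, of degree δ: 3 if a ≥ 3, and 2 if a = 2. -/
theorem q_pairedArray (ha : 2 ≤ a) (hb : 2 ≤ b) (e : Plot a b ↪ Fin t) {δ : ℕ}
    (hδ : δ = 1 + lineDegree a 1) (x : ℝ) :
    q 1 (pairedArray e) x = distinctQ a b t x
      + 4 * (2 * x - (1 + x * 2) * (1 + x * δ) / (a * b)) := by
  classical
  rw [q_one_eq_distinctQ_add ha hb]
  congr 1
  rw [← Fintype.sum_prod_type' (f := fun v w =>
    if v ≠ w ∧ (pairedArray e).treat v = (pairedArray e).treat w then pairKernel x v w else 0),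
    ← Finset.sum_filter]
  have hval : ∀ z ∈ Finset.univ.filter (fun z : Plot a b × Plot a b => z.1 ≠ z.2 ∧
      (pairedArray e).treat z.1 = (pairedArray e).treat z.2),
      pairKernel x z.1 z.2 = 2 * x - (1 + x * 2) * (1 + x * δ) / (a * b) := by
    rintro ⟨⟨j, i⟩, ⟨l, k⟩⟩ hz
    have hz' := (Finset.mem_filter.1 hz).2
    rw [pairKernel_of_adjacent x (pairedArray_pair e hz'.1 hz'.2).1]
    rw [pairedArray_eq_iff] at hz'
    obtain ⟨h1, h2, h3⟩ := hz'
    simp only at h1 h2 h3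
    subst h1
    have h4 : lineDegree b j = 1 := by unfold lineDegree; split_ifs <;> omega
    have h5 : lineDegree a 0 = 1 := by unfold lineDegree; split_ifs <;> omega
    rcases h3 with ⟨h, h'⟩ | ⟨h, h'⟩ <;> simp only [plotDegree, h, h', h4, h5, hδ] <;> push_cast <;>
      ring
  rw [Finset.sum_congr rfl hval, Finset.sum_const, nsmul_eq_mul]
  congr 1
  have hset : Finset.univ.filter (fun z : Plot a b × Plot a b => z.1 ≠ z.2 ∧
      (pairedArray e).treat z.1 = (pairedArray e).treat z.2)
      = {((⟨0, by omega⟩, ⟨0, by omega⟩), (⟨0, by omega⟩, ⟨1, by omega⟩)),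
        ((⟨0, by omega⟩, ⟨1, by omega⟩), (⟨0, by omega⟩, ⟨0, by omega⟩)),
        ((⟨b - 1, by omega⟩, ⟨0, by omega⟩), (⟨b - 1, by omega⟩, ⟨1, by omega⟩)),
        ((⟨b - 1, by omega⟩, ⟨1, by omega⟩), (⟨b - 1, by omega⟩, ⟨0, by omega⟩))} := by
    ext ⟨⟨j, i⟩, ⟨l, k⟩⟩
    rw [Finset.mem_filter, pairedArray_eq_iff]
    simp only [Finset.mem_univ, true_and, Finset.mem_insert, Finset.mem_singleton, Prod.mk.injEq, Fin.ext_iff]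
    omega
  rw [hset]
  have hb1 : b - 1 ≠ 0 := by omega
  rw [Finset.card_insert_of_notMem, Finset.card_insert_of_notMem, Finset.card_insert_of_notMem,
    Finset.card_singleton] <;> simp [hb1.symm]

end Arrays

/-! ### Optimality for the block sizes at hand -/

section Optimum

/-- Half the derivative of `distinctQ`. -/
def distinctSlope (a b t : ℕ) (x : ℝ) : ℝ :=
  -(4 * (a * b) - 2 * a - 2 * b) / (a * b) + distinctC11 a b t * x

/-- The term added to the slope in `hD1` is half the derivative of the correction in
`q_pairedArray`. -/
theorem isOptimalTriple_of_kernel (ha : 2 ≤ a) (hb : 2 ≤ b) (ht : a * b ≤ t) {x : ℝ}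
    {Good : Plot a b → Plot a b → Prop}
    (h0 : ∀ v w : Plot a b, v ≠ w → Good v w → pairKernel x v w = 0)
    (h1 : ∀ v w : Plot a b, v ≠ w → ¬ Good v w → pairKernel x v w < 0)
    (hpair : ∀ (e : Plot a b ↪ Fin t) (v w : Plot a b), v ≠ w →
      (pairedArray e).treat v = (pairedArray e).treat w → Good v w)
    {δ : ℕ} (hδ : δ = 1 + lineDegree a 1) (hD0 : distinctSlope a b t x ≤ 0)
    (hD1 : distinctSlope a b t x = 0 ∨
      0 < distinctSlope a b t x + 2 * (2 - (2 + δ + 4 * δ * x) / (a * b))) :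
    IsOptimalTriple (1 : Matrix (Plot a b) (Plot a b) ℝ) x (distinctQ a b t x)
      {s : BlockArray a b t | ∀ v w, v ≠ w → s.treat v = s.treat w → Good v w} := by
  have hnn : ∀ (s : BlockArray a b t) (x : ℝ), 0 ≤ q 1 s x :=
    q_one_nonneg (Nat.mul_pos (by omega) (by omega))
  have hcrit := fun s : BlockArray a b t => q_one_le_and_eq_iff ha hb h0 h1 s
  obtain ⟨e⟩ : Nonempty (Plot a b ↪ Fin t) :=
    Function.Embedding.nonempty_of_card_le (by simpa [mul_comm] using ht)
  have ha' : (2 : ℝ) ≤ a := by exact_mod_cast ha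
  have hb' : (2 : ℝ) ≤ b := by exact_mod_cast hb
  obtain ⟨hβ, hγ⟩ := coeffs_of_q_eq (Sig := 1) (s := distinctArray e) fun x =>
    (q_distinctArray ha hb e x).trans rfl
  have hpos : 0 < c11 1 (distinctArray e) := by
    obtain ⟨h2, h3⟩ := quadratic_coeffs_of_nonneg (hnn (distinctArray e))
    -- A vanishing c₁₁ would force c₀₁ = 0, but c₀₁ is minus the mean degree.
    refine h2.lt_of_ne fun h => ?_
    have h4 := h3 h.symm
    rw [hβ] at h4
    have h5 : 0 < (4 * ((a : ℝ) * b) - 2 * a - 2 * b) / (a * b) := by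
      apply div_pos
      · nlinarith
      · positivity
    rw [neg_div] at h4
    linarith
  obtain ⟨hβ', hγ'⟩ := coeffs_of_q_eq (Sig := 1) (s := pairedArray e)
    (α := a * b - 1 - 4 / (a * b))
    (β := -(4 * (a * b) - 2 * a - 2 * b) / (a * b) + 4 - 2 * (2 + δ) / (a * b))
    (γ := distinctC11 a b t - 8 * δ / (a * b)) fun x => by
      rw [q_pairedArray ha hb e hδ, distinctQ]
      ring
  have hset : {s : BlockArray a b t | ∀ v w, v ≠ w → s.treat v = s.treat w → Good v w}
      = {s | q 1 s x = distinctQ a b t x} := by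
    ext s
    exact (hcrit s).2.symm
  rw [hset]
  refine isOptimalTriple_of_two hnn (fun s => (hcrit s).1) (distinctArray e) (pairedArray e)
    (q_distinctArray ha hb e x) ((hcrit _).2.2 (hpair e)) hpos ?_ ?_
  · rw [hβ, hγ]; exact hD0
  · rw [hβ, hγ, hβ', hγ']
    refine hD1.imp id fun h => ?_
    unfold distinctSlope at h
    linear_combination h

/-- Substituting a = 2 + m, b = 2 + n makes every coefficient of the difference nonnegative. The
bound is the sum S of the degrees, so for 0 ≤ x ≤ 1/p the slope is at most -S/p + S/p = 0. -/
theorem distinctC11_le (ha : 2 ≤ a) (hb : 2 ≤ b) :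
    distinctC11 a b t ≤ 4 * (a * b) - 2 * a - 2 * b := by
  obtain ⟨m, rfl⟩ := Nat.exists_eq_add_of_le ha
  obtain ⟨n, rfl⟩ := Nat.exists_eq_add_of_le hb
  have hm : (0 : ℝ) ≤ m := m.cast_nonneg
  have hn : (0 : ℝ) ≤ n := n.cast_nonneg
  have h1 : 4 * (((2 + m : ℕ) : ℝ) * (2 + n : ℕ)) - 2 * (2 + m : ℕ) - 2 * (2 + n : ℕ)
      - distinctC11 (2 + m) (2 + n) t
      = (2 * (4 * (m + n) + 8 * (m * n) + m * n * (m + n)) / ((2 + m) * (2 + n))) / t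
        + (16 + 18 * (m + n) + 16 * (m * n)) / ((2 + m) * (2 + n)) := by
    rw [distinctC11, eta]
    push_cast
    have : (2 + m : ℝ) ≠ 0 := by positivity
    have : (2 + n : ℝ) ≠ 0 := by positivity
    field_simp
    ring
  rw [← sub_nonneg, h1]
  positivity

theorem distinctSlope_nonpos (ha : 2 ≤ a) (hb : 2 ≤ b) {x : ℝ} (hx : 0 ≤ x)
    (hxp : x * (a * b) ≤ 1) : distinctSlope a b t x ≤ 0 := by
  have ha' : (2 : ℝ) ≤ a := by exact_mod_cast ha
  have hb' : (2 : ℝ) ≤ b := by exact_mod_cast hb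
  have hp : (0 : ℝ) < a * b := by positivity
  have h1 : 0 ≤ 4 * ((a : ℝ) * b) - 2 * a - 2 * b := by nlinarith
  have h2 : x ≤ 1 / (a * b) := by rwa [le_div_iff₀ hp]
  calc distinctSlope a b t x
      ≤ -(4 * (a * b) - 2 * a - 2 * b) / (a * b)
          + (4 * (a * b) - 2 * a - 2 * b) * (1 / (a * b)) := by
        rw [distinctSlope]
        gcongr
        exact distinctC11_le ha hb
    _ = 0 := by ring

theorem plotDegree_bounds (ha : 2 ≤ a) (hb : 2 ≤ b) (v : Plot a b) :
    2 ≤ plotDegree v ∧ plotDegree v ≤ 4 := by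
  have h1 := one_le_lineDegree ha v.2
  have h2 := one_le_lineDegree hb v.1
  have h3 := lineDegree_le a v.2
  have h4 := lineDegree_le b v.1
  unfold plotDegree
  omega

theorem three_le_plotDegree (ha : 2 ≤ a) (hb : 2 ≤ b) {v : Plot a b} (hv : ¬ IsCorner v) :
    3 ≤ plotDegree v := by
  have h1 := (plotDegree_bounds ha hb v).1
  rw [isCorner_iff ha hb] at hv
  omega

theorem plotDegree_of_adjacent_corner (ha : 3 ≤ a) (hb : 3 ≤ b) {v w : Plot a b}
    (h : Adjacent v w) (hv : IsCorner v) : plotDegree w = 3 := by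
  obtain ⟨j, i⟩ := v
  obtain ⟨l, k⟩ := w
  simp only [Adjacent, IsCorner, plotDegree, lineDegree, Fin.ext_iff] at *
  split_ifs <;> omega

/-! ### Blocks with at least three rows and columns -/

section LargeBlocks

variable {x : ℝ}

theorem pairKernel_eq_zero_of_large (ha : 3 ≤ a) (hb : 3 ≤ b)
    (hx : 6 * x ^ 2 + 5 * x + 1 = 2 * (a * b) * x) {v w : Plot a b} (h : Adjacent v w)
    (hc : IsCorner v ∨ IsCorner w) : pairKernel x v w = 0 := by
  have hp : (0 : ℝ) < a * b := by positivity
  rw [pairKernel_of_adjacent x h, sub_eq_zero, eq_div_iff hp.ne']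
  rcases hc with hc | hc
  · rw [plotDegree_of_adjacent_corner ha hb h hc, (isCorner_iff (by omega) (by omega) v).1 hc]
    push_cast
    linear_combination -hx
  · rw [plotDegree_of_adjacent_corner ha hb h.symm hc,
      (isCorner_iff (by omega) (by omega) w).1 hc]
    push_cast
    linear_combination -hx

/-- The equation `hx` says 2px = (1 + 2x)(1 + 3x). Adjacent non-corners have degrees at least 3, and
2px < (1 + 3x)². For non-adjacent plots, x²p d_v ≤ x d_v because xp ≤ 1. -/
theorem pairKernel_neg_of_large (ha : 3 ≤ a) (hb : 3 ≤ b) (hx0 : 0 < x) (hxp : x * (a * b) ≤ 1)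
    (hx : 6 * x ^ 2 + 5 * x + 1 = 2 * (a * b) * x) {v w : Plot a b} (hvw : v ≠ w)
    (hc : ¬ (Adjacent v w ∧ (IsCorner v ∨ IsCorner w))) : pairKernel x v w < 0 := by
  have hp : (0 : ℝ) < a * b := by positivity
  by_cases h : Adjacent v w
  · simp only [h, true_and, not_or] at hc
    have hv : (3 : ℝ) ≤ plotDegree v := by
      exact_mod_cast three_le_plotDegree (by omega) (by omega) hc.1
    have hw : (3 : ℝ) ≤ plotDegree w := by
      exact_mod_cast three_le_plotDegree (by omega) (by omega) hc.2
    rw [pairKernel_of_adjacent x h, sub_neg, lt_div_iff₀ hp]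
    calc 2 * x * (a * b) < (1 + x * 3) * (1 + x * 3) := by nlinarith
      _ ≤ _ := by gcongr
  · refine pairKernel_neg_of_not_adjacent hvw h hp ?_
    have hw : (0 : ℝ) ≤ plotDegree w := Nat.cast_nonneg _
    have hv : (0 : ℝ) ≤ plotDegree v := Nat.cast_nonneg _
    have h1 : 0 ≤ x * plotDegree v := by positivity
    have h2 : 0 ≤ x * plotDegree w := by positivity
    nlinarith [mul_le_mul_of_nonneg_left hxp h1, mul_nonneg h1 h2]

theorem isOptimalTriple_of_large (ha : 3 ≤ a) (hb : 3 ≤ b) (ht : a * b ≤ t) (hx0 : 0 < x)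
    (hx12 : x < 1 / 12) (hx : 6 * x ^ 2 + 5 * x + 1 = 2 * (a * b) * x) :
    IsOptimalTriple (1 : Matrix (Plot a b) (Plot a b) ℝ) x (distinctQ a b t x)
      {s : BlockArray a b t | RepeatsSignificant s} := by
  have ha' : (3 : ℝ) ≤ a := by exact_mod_cast ha
  have hb' : (3 : ℝ) ≤ b := by exact_mod_cast hb
  have hp : (0 : ℝ) < a * b := by positivity
  have hxp : x * (a * b) ≤ 1 := by nlinarith
  have hδ : 3 = 1 + lineDegree a 1 := by
    rw [lineDegree, if_neg one_ne_zero, if_neg (by omega)]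
  obtain ⟨e⟩ : Nonempty (Plot a b ↪ Fin t) :=
    Function.Embedding.nonempty_of_card_le (by simpa [mul_comm] using ht)
  refine isOptimalTriple_of_kernel (by omega) (by omega) ht
    (fun v w _ h => pairKernel_eq_zero_of_large ha hb hx h.1 h.2)
    (fun v w hvw h => pairKernel_neg_of_large ha hb hx0 hxp hx hvw h)
    (fun e v w hvw h => pairedArray_pair e hvw h) hδ
    (distinctSlope_nonpos (by omega) (by omega) hx0.le hxp) (Or.inr ?_)
  have hγ : 0 ≤ distinctC11 a b t := by
    rw [← (coeffs_of_q_eq (Sig := 1) (s := distinctArray e) fun x =>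
      (q_distinctArray (by omega) (by omega) e x).trans rfl).2]
    exact (quadratic_coeffs_of_nonneg
      (q_one_nonneg (Nat.mul_pos (by omega) (by omega)) (distinctArray e))).1
  have h1 : distinctSlope a b t x + 2 * (2 - (2 + (3 : ℕ) + 4 * (3 : ℕ) * x) / (a * b))
      = (2 * (a + b) - 10 - 24 * x) / (a * b) + distinctC11 a b t * x := by
    rw [distinctSlope]
    field_simp
    push_cast
    ring
  rw [h1]
  -- Here a + b ≥ 6 leaves 2 - 24x, which is positive because x < 1/12.
  have h2 : 0 < (2 * (a + b) - 10 - 24 * x) / (a * b) := div_pos (by linarith) hp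
  positivity

end LargeBlocks

/-! ### Blocks with two rows -/

section TwoRows

variable {x : ℝ}

theorem pairKernel_neg_of_two_rows (hb : 2 ≤ b) (hx0 : 0 < x) (hx2 : x ≤ 1 / 2)
    (hx : (1 + 2 * x) ^ 2 = 4 * b * x) {v w : Plot 2 b} (hvw : v ≠ w)
    (hc : ¬ (Adjacent v w ∧ IsCorner v ∧ IsCorner w)) : pairKernel x v w < 0 := by
  have hp : (0 : ℝ) < (2 : ℕ) * b := by positivity
  have hv2 : (2 : ℝ) ≤ plotDegree v := by exact_mod_cast (plotDegree_bounds le_rfl hb v).1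
  have hw2 : (2 : ℝ) ≤ plotDegree w := by exact_mod_cast (plotDegree_bounds le_rfl hb w).1
  by_cases h : Adjacent v w
  · rw [pairKernel_of_adjacent x h, sub_neg, lt_div_iff₀ hp]
    push_cast
    simp only [h, true_and, not_and_or] at hc
    rcases hc with hc | hc
    · have hv : (3 : ℝ) ≤ plotDegree v := by exact_mod_cast three_le_plotDegree le_rfl hb hc
      calc 2 * x * (2 * b) < (1 + x * 3) * (1 + x * 2) := by nlinarith
        _ ≤ _ := by gcongr
    · have hw : (3 : ℝ) ≤ plotDegree w := by exact_mod_cast three_le_plotDegree le_rfl hb hc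
      calc 2 * x * (2 * b) < (1 + x * 2) * (1 + x * 3) := by nlinarith
        _ ≤ _ := by gcongr
  · refine pairKernel_neg_of_not_adjacent hvw h hp ?_
    have hv3 : (plotDegree v : ℝ) ≤ 3 := by
      have h1 := lineDegree_le b v.1
      have h2 : lineDegree 2 v.2 = 1 := by
        unfold lineDegree
        split_ifs <;> omega
      have h3 : plotDegree v ≤ 3 := by unfold plotDegree; omega
      exact_mod_cast h3
    -- The bound xp ≤ 1 fails for b = 2, where xp = 2. Instead the equation for x, degree at most 3
    -- and x ≤ 1/2 give the factor 3/4 < 1.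
    calc x ^ 2 * ((2 : ℕ) * b) * plotDegree v
        = (1 + 2 * x) ^ 2 * (x * plotDegree v / 2) := by
          rw [hx]
          push_cast
          ring
      _ ≤ (1 + 2 * x) ^ 2 * (1 / 2 * 3 / 2) := by gcongr
      _ < (1 + x * 2) * (1 + x * 2) := by nlinarith
      _ ≤ _ := by gcongr

theorem isOptimalTriple_of_two_rows (hb : 2 ≤ b) (ht : 2 * b ≤ t) (hx0 : 0 < x) (hx2 : x ≤ 1 / 2)
    (hx : (1 + 2 * x) ^ 2 = 4 * b * x) (hD0 : distinctSlope 2 b t x ≤ 0)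
    (hD1 : distinctSlope 2 b t x = 0 ∨
      0 < distinctSlope 2 b t x + 2 * (2 - (2 + 4 * x) / b)) :
    IsOptimalTriple (1 : Matrix (Plot 2 b) (Plot 2 b) ℝ) x (distinctQ 2 b t x)
      {s : BlockArray 2 b t | RepeatsStrictlySignificant s} := by
  refine isOptimalTriple_of_kernel le_rfl hb ht (fun v w _ h => ?_)
    (fun v w hvw h => pairKernel_neg_of_two_rows hb hx0 hx2 hx hvw h)
    (fun e v w hvw h => ⟨(pairedArray_pair e hvw h).1, ?_⟩) (δ := 2) rfl hD0
    (hD1.imp id fun h => ?_)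
  · have hb' : (b : ℝ) ≠ 0 := by positivity
    rw [pairKernel_of_adjacent x h.1, (isCorner_iff le_rfl hb v).1 h.2.1,
      (isCorner_iff le_rfl hb w).1 h.2.2]
    push_cast
    field_simp
    linear_combination -hx
  · have := (pairedArray_eq_iff e v w).1 ⟨hvw, h⟩
    unfold IsCorner
    simp only [Fin.ext_iff] at this
    omega
  · refine h.trans_eq ?_
    push_cast
    ring

/-- The bound x < 1/5 gives xp = (1 + 2x)²/2 < 1, hence a nonpositive slope for distinct treatments.
The slope of the paired array is 1 - 2/b + (c₁₁ - 8/b)x, which is positive since 8/b ≤ 5 ≤ c₁₁. -/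
theorem isOptimalTriple_of_two_rows_long (hb : 3 ≤ b) (ht : 2 * b ≤ t) (hx0 : 0 < x)
    (hx5 : x < 1 / 5) (hx : (1 + 2 * x) ^ 2 = 4 * b * x) :
    IsOptimalTriple (1 : Matrix (Plot 2 b) (Plot 2 b) ℝ) x (distinctQ 2 b t x)
      {s : BlockArray 2 b t | RepeatsStrictlySignificant s} := by
  have hb' : (3 : ℝ) ≤ b := by exact_mod_cast hb
  have ht' : (2 * b : ℝ) ≤ t := by exact_mod_cast ht
  have hb0 : (0 : ℝ) < b := by linarith
  have ht0 : (0 : ℝ) < t := by linarith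
  refine isOptimalTriple_of_two_rows (by omega) ht hx0 (by linarith) hx
    (distinctSlope_nonpos le_rfl (by omega) hx0.le (by push_cast; nlinarith)) (Or.inr ?_)
  have hγ : 5 ≤ distinctC11 2 b t := by
    have h1 : distinctC11 2 b t = (6 * b - 13) + (10 / b - 4 / t) + 8 / (b * t) := by
      rw [distinctC11, eta]
      push_cast
      field_simp
      ring
    have h2 : 4 / (t : ℝ) ≤ 10 / b := by
      rw [div_le_div_iff₀ ht0 hb0]
      linarith
    have h3 : (0 : ℝ) ≤ 8 / (b * t) := by positivity
    linarith
  have h1 : distinctSlope 2 b t x + 2 * (2 - (2 + 4 * x) / b)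
      = 1 - 2 / b - 8 / b * x + distinctC11 2 b t * x := by
    rw [distinctSlope]
    push_cast
    field_simp
    ring
  rw [h1]
  have h2 : 2 / (b : ℝ) < 1 := by rw [div_lt_one hb0]; linarith
  have h3 : 8 / (b : ℝ) ≤ 5 := by rw [div_le_iff₀ hb0]; linarith
  have h4 := mul_le_mul_of_nonneg_right (h3.trans hγ) hx0.le
  linarith

end TwoRows

/-! ### The minimizers -/

theorem smaller_root_of_large {P x : ℝ} (hP : 9 ≤ P)
    (hx : x = ((2 * P - 5) - √((2 * P - 5) ^ 2 - 24)) / 12) :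
    0 < x ∧ x < 1 / 12 ∧ 6 * x ^ 2 + 5 * x + 1 = 2 * P * x := by
  have hD : 0 ≤ (2 * P - 5) ^ 2 - 24 := by nlinarith
  have hs := Real.sq_sqrt hD
  have h1 : √((2 * P - 5) ^ 2 - 24) < 2 * P - 5 := by
    rw [Real.sqrt_lt' (by linarith)]
    linarith
  -- Equivalent to x < 1/12; squaring leaves 4P - 11 > 24, which P ≥ 9 ensures.
  have h2 : 2 * P - 6 < √((2 * P - 5) ^ 2 - 24) := by
    apply Real.lt_sqrt_of_sq_lt
    nlinarith
  refine ⟨by linarith, by linarith, ?_⟩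
  have h3 : √((2 * P - 5) ^ 2 - 24) = 2 * P - 5 - 12 * x := by linarith
  rw [h3] at hs
  linear_combination hs / 24

theorem irrational_smaller_root {p : ℕ} (hp : 9 ≤ p) :
    Irrational (((2 * p - 5) - √((2 * (p : ℝ) - 5) ^ 2 - 24)) / 12) := by
  obtain ⟨n, rfl⟩ := Nat.exists_eq_add_of_le hp
  -- With p = 9 + n the radicand lies strictly between (2n + 12)² and (2n + 13)², whose gap 4n + 25
  -- exceeds 24.
  have hsq : ¬ IsSquare ((2 * n + 13) ^ 2 - 24) := by
    rintro ⟨m, hm⟩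
    have h1 : (2 * n + 13) ^ 2 = m * m + 24 := by
      have : 24 ≤ (2 * n + 13) ^ 2 := by nlinarith
      omega
    have h2 : m < 2 * n + 13 := by nlinarith
    have h3 : 2 * n + 12 < m := by nlinarith
    omega
  have hirr := irrational_sqrt_natCast_iff.2 hsq
  have hcast : (((2 * n + 13) ^ 2 - 24 : ℕ) : ℝ) = (2 * ((9 + n : ℕ) : ℝ) - 5) ^ 2 - 24 := by
    rw [Nat.cast_sub (by nlinarith)]
    push_cast
    ring
  rw [hcast] at hirr
  rintro ⟨y, hy⟩
  refine hirr ⟨2 * (9 + n : ℕ) - 5 - 12 * y, ?_⟩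
  push_cast at hy ⊢
  linarith

theorem smaller_root_of_two_rows {c x : ℝ} (hc : 3 ≤ c)
    (hx : x = (c - 1 - √((c - 1) ^ 2 - 1)) / 2) :
    0 < x ∧ x < 1 / 5 ∧ (1 + 2 * x) ^ 2 = 4 * c * x := by
  have hD : 0 ≤ (c - 1) ^ 2 - 1 := by nlinarith
  have hs := Real.sq_sqrt hD
  have h1 : √((c - 1) ^ 2 - 1) < c - 1 := by
    rw [Real.sqrt_lt' (by linarith)]
    linarith
  have h2 : c - 7 / 5 < √((c - 1) ^ 2 - 1) := by
    apply Real.lt_sqrt_of_sq_lt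
    nlinarith
  refine ⟨by linarith, by linarith, ?_⟩
  have h3 : √((c - 1) ^ 2 - 1) = c - 1 - 2 * x := by linarith
  rw [h3] at hs
  linear_combination hs

end Optimum

end Interference

end

/-! ### The three cases of the theorem -/

theorem mainTheorem9 (a b t p : ℕ) (hab : a ≤ b) (hp : p = a * b) (ht : p ≤ t) :
    (3 ≤ a → ∀ x : ℝ, x = ((2 * p - 5) - √((2 * (p : ℝ) - 5) ^ 2 - 24)) / 12 →
      Irrational x ∧
      Interference.IsOptimalTriple (1 : Matrix (Interference.Plot a b) (Interference.Plot a b) ℝ)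
        x
        (p - (p + 2) / p + 2 * ((2 * a + 2 * b - 5) / p - 2) * x
          + (Interference.eta a b t - (16 * p - 14 * a - 14 * b + 20) / p) * x ^ 2)
        (⋃ i ∈ Finset.range 5, Interference.QSet a b t i)) ∧
    (a = 2 → 3 ≤ b → ∀ x : ℝ, x = (b - 1 - √(((b : ℝ) - 1) ^ 2 - 1)) / 2 →
      Interference.IsOptimalTriple (1 : Matrix (Interference.Plot a b) (Interference.Plot a b) ℝ)
        x
        (2 * b - 1 + (4 / b - 6) * x + (Interference.eta a b t - 9 + 10 / b) * x ^ 2)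
        (Interference.QSet a b t 0 ∪ Interference.QStarSet a b t 1
          ∪ Interference.QStarSet a b t 2)) ∧
    (a = 2 → b = 2 →
      Interference.IsOptimalTriple (1 : Matrix (Interference.Plot a b) (Interference.Plot a b) ℝ)
        (1 / 2) 2
        (Interference.QSet a b t 0 ∪ Interference.QStarSet a b t 1
          ∪ Interference.QStarSet a b t 2)) := by
  subst hp
  refine ⟨fun ha x hx => ?_, fun ha hb x hx => ?_, fun ha hb => ?_⟩
  · have hb : 3 ≤ b := ha.trans hab
    have hp9 : 9 ≤ a * b := Nat.mul_le_mul ha hb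
    refine ⟨hx ▸ Interference.irrational_smaller_root hp9, ?_⟩
    obtain ⟨h0, h12, hroot⟩ := Interference.smaller_root_of_large (by exact_mod_cast hp9) hx
    push_cast at hroot ⊢
    rw [Interference.iUnion_QSet_eq]
    convert Interference.isOptimalTriple_of_large ha hb ht h0 h12 hroot using 1
    have ha0 : (a : ℝ) ≠ 0 := by positivity
    have hb0 : (b : ℝ) ≠ 0 := by positivity
    rw [Interference.distinctQ, Interference.distinctC11]
    field_simp
    -- The stated y* is written as the value of an array with one significant treatment; it differs
    -- from the distinct value by a multiple of the equation for x*.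
    linear_combination -2 * hroot
  · subst ha
    obtain ⟨h0, h5, hroot⟩ := Interference.smaller_root_of_two_rows (by exact_mod_cast hb) hx
    rw [Interference.QSet_union_QStarSet_eq]
    convert Interference.isOptimalTriple_of_two_rows_long hb ht h0 h5 hroot using 1
    have hb0 : (b : ℝ) ≠ 0 := by positivity
    rw [Interference.distinctQ, Interference.distinctC11]
    push_cast
    field_simp
    ring
  · subst ha hb
    -- For the 2 × 2 block the terms in 1/t cancel, and the distinct quadratic 3 - 4x + 4x² has its
    -- vertex at 1/2, so no mixing is needed.
    have hγ : Interference.distinctC11 2 2 t = 4 := by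
      rw [Interference.distinctC11, Interference.eta]
      push_cast
      ring
    have hslope : Interference.distinctSlope 2 2 t (1 / 2) = 0 := by
      rw [Interference.distinctSlope, hγ]
      norm_num
    rw [Interference.QSet_union_QStarSet_eq]
    convert Interference.isOptimalTriple_of_two_rows le_rfl ht (x := 1 / 2) (by norm_num) le_rfl
      (by norm_num) hslope.le (Or.inl hslope) using 1
    rw [Interference.distinctQ, hγ]
    norm_num
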